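/- For a finite group $G$ let $R(G)$ be its ring of virtual complex characters, with augmentation $\epsilon:R(G)\to\mathbb Z$ (the degree) and augmentation ideal $I=\ker\epsilon$. Let $\lambda^n$ be the operations on $R(G)$ induced by exterior powers of representations, extended to virtual characters by $\lambda_t(V-W)=\lambda_t(V)\,\lambda_t(W)^{-1}$, where $\lambda_t=\sum_{n\ge 0}\lambda^n t^n$; put $\gamma^n(x)=\lambda^n(x+n-1)$. The Grothendieck filtration is $$\Gamma^n(G)=\Big\langle\, \gamma^{n_1}(x_1)\cdots\gamma^{n_k}(x_k)\ :\ x_i\in I,\ \sum_i n_i\ge n \Big\rangle$$ (the additive subgroup of $R(G)$ generated by these monomials), and the saturated filtration is $$F^n(G)=\sum_{H\le G}\operatorname{Ind}_H^G\big(\Gamma^n(H)\big).$$ The group $G$ is called saturated if $F^n(G)=\Gamma^n(G)$ for all $n\ge 0$. Theorem. The quaternion group $Q_8$ is saturated, and for every odd prime $p$ the dihedral group $D_p$ of order $2p$ is saturated. Moreover, if $G$ is any of these groups, then $\operatorname{Ind}_H^G(\Gamma^n(H))\subseteq\Gamma^n(G)$ for every subgroup $H\le G$ (in particular for the maximal cyclic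 subgroups) and every $n\ge 0$. -/

import Mathlib

noncomputable section

namespace CharacterRing

open Representation

/-! ### Characters and the ring of virtual characters -/

section Basic

variable {G : Type} [Group G]

/-- `χ` is the character of a finite-dimensional complex representation of `G`. -/
def IsCharacter (χ : G → ℂ) : Prop :=
  ∃ (V : Type) (_ : AddCommGroup V) (_ : Module ℂ V) (_ : FiniteDimensional ℂ V)
    (ρ : Representation ℂ G V), ρ.character = χ

theorem isCharacter_character {V : Type} [AddCommGroup V] [Module ℂ V] [FiniteDimensional ℂ V]
    (ρ : Representation ℂ G V) : IsCharacter ρ.character :=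
  ⟨V, _, _, ‹_›, ρ, rfl⟩

theorem character_prod {V W : Type} [AddCommGroup V] [Module ℂ V] [FiniteDimensional ℂ V]
    [AddCommGroup W] [Module ℂ W] [FiniteDimensional ℂ W]
    (ρ : Representation ℂ G V) (σ : Representation ℂ G W) :
    (ρ.prod σ).character = ρ.character + σ.character := by
  ext g
  exact LinearMap.trace_prodMap' (ρ g) (σ g)

theorem IsCharacter.add {χ ψ : G → ℂ} (hχ : IsCharacter χ) (hψ : IsCharacter ψ) :
    IsCharacter (χ + ψ) := by
  obtain ⟨V, _, _, _, ρ, rfl⟩ := hχ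
  obtain ⟨W, _, _, _, σ, rfl⟩ := hψ
  rw [← character_prod]
  exact isCharacter_character _

theorem IsCharacter.mul {χ ψ : G → ℂ} (hχ : IsCharacter χ) (hψ : IsCharacter ψ) :
    IsCharacter (χ * ψ) := by
  obtain ⟨V, _, _, _, ρ, rfl⟩ := hχ
  obtain ⟨W, _, _, _, σ, rfl⟩ := hψ
  rw [← char_tensor]
  exact isCharacter_character _

theorem isCharacter_zero : IsCharacter (0 : G → ℂ) := by
  refine ⟨PUnit, inferInstance, inferInstance, inferInstance, Representation.trivial ℂ G PUnit, ?_⟩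
  ext g
  have : (Representation.trivial ℂ G PUnit) g = 0 := Subsingleton.elim _ _
  simp [character, this]

theorem isCharacter_one : IsCharacter (1 : G → ℂ) := by
  refine ⟨ℂ, inferInstance, inferInstance, inferInstance, Representation.trivial ℂ G ℂ, ?_⟩
  ext g
  have : (Representation.trivial ℂ G ℂ) g = LinearMap.id := rfl
  simp [character, this]

variable (G) in
/-- The ring `R(G)` of virtual characters of `G` over `ℂ`: all differences of characters, with
pointwise operations. -/
def VirtualChar : Subring (G → ℂ) where
  carrier := {f | ∃ χ ψ : G → ℂ, IsCharacter χ ∧ IsCharacter ψ ∧ f = χ - ψ}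
  mul_mem' := by
    rintro _ _ ⟨a, b, ha, hb, rfl⟩ ⟨c, d, hc, hd, rfl⟩
    exact ⟨a * c + b * d, a * d + b * c, (ha.mul hc).add (hb.mul hd),
      (ha.mul hd).add (hb.mul hc), by ring⟩
  one_mem' := ⟨1, 0, isCharacter_one, isCharacter_zero, by simp⟩
  add_mem' := by
    rintro _ _ ⟨a, b, ha, hb, rfl⟩ ⟨c, d, hc, hd, rfl⟩
    exact ⟨a + c, b + d, ha.add hc, hb.add hd, by ring⟩
  zero_mem' := ⟨0, 0, isCharacter_zero, isCharacter_zero, by simp⟩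
  neg_mem' := by
    rintro _ ⟨a, b, ha, hb, rfl⟩
    exact ⟨b, a, hb, ha, by ring⟩

theorem IsCharacter.mem {χ : G → ℂ} (h : IsCharacter χ) : χ ∈ VirtualChar G :=
  ⟨χ, 0, h, isCharacter_zero, by simp⟩

/-- The class in `R(G)` of a finite-dimensional representation. -/
def ofRep {V : Type} [AddCommGroup V] [Module ℂ V] [FiniteDimensional ℂ V]
    (ρ : Representation ℂ G V) : VirtualChar G :=
  ⟨ρ.character, (isCharacter_character ρ).mem⟩

theorem exists_eq_ofRep_sub (x : VirtualChar G) :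
    ∃ (V W : Type) (_ : AddCommGroup V) (_ : Module ℂ V) (_ : FiniteDimensional ℂ V)
      (_ : AddCommGroup W) (_ : Module ℂ W) (_ : FiniteDimensional ℂ W)
      (ρ : Representation ℂ G V) (σ : Representation ℂ G W), x = ofRep ρ - ofRep σ := by
  obtain ⟨x, _, _, ⟨V, _, _, _, ρ, rfl⟩, ⟨W, _, _, _, σ, rfl⟩, rfl⟩ := x
  exact ⟨V, W, _, _, ‹_›, _, _, ‹_›, ρ, σ, rfl⟩

variable (G) in
/-- The augmentation of `R(G)`: the value at `1`, which sends a character to its degree. -/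
def augmentation : VirtualChar G →+* ℂ :=
  (Pi.evalRingHom (fun _ : G => ℂ) 1).comp (VirtualChar G).subtype

theorem augmentation_ofRep {V : Type} [AddCommGroup V] [Module ℂ V] [FiniteDimensional ℂ V]
    (ρ : Representation ℂ G V) : augmentation G (ofRep ρ) = Module.finrank ℂ V :=
  char_one ρ

/-- The `n`-th exterior power of a representation. -/
def extPower {V : Type} [AddCommGroup V] [Module ℂ V] (ρ : Representation ℂ G V) (n : ℕ) :
    Representation ℂ G (⋀[ℂ]^n V) where
  toFun g := exteriorPower.map n (ρ g)
  map_one' := by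
    rw [map_one]
    exact exteriorPower.map_id
  map_mul' g h := by
    rw [map_mul]
    exact exteriorPower.map_comp (ρ h) (ρ g)

/-- `λ_t(V) = ∑ [Λⁿ V] tⁿ`, for an actual representation `V`. -/
def lambdaSeriesRep {V : Type} [AddCommGroup V] [Module ℂ V] [FiniteDimensional ℂ V]
    (ρ : Representation ℂ G V) : PowerSeries (VirtualChar G) :=
  PowerSeries.mk fun n => ofRep (extPower ρ n)

end Basic

/-! ### Exterior powers of virtual characters are well defined -/

section Lambda

/-- The power series `∑_{k ≥ 1} (-1)^(k+1) p_k t^k`. -/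
def altSeries (p : ℕ → ℂ) : PowerSeries ℂ :=
  PowerSeries.mk fun k => if k = 0 then 0 else (-1) ^ (k + 1) * p k

theorem exists_eigenbasis {V : Type} [AddCommGroup V] [Module ℂ V] [FiniteDimensional ℂ V]
    (f : Module.End ℂ V) {N : ℕ} (hN : N ≠ 0) (hf : f ^ N = 1) :
    ∃ (d : ℕ) (b : Module.Basis (Fin d) ℂ V) (μ : Fin d → ℂ), ∀ i, f (b i) = μ i • b i := by
  classical
  have hss : f.IsSemisimple := by
    refine Module.End.isSemisimple_of_squarefree_aeval_eq_zero
      (p := (Polynomial.X ^ N - 1 : Polynomial ℂ)) ?_ (by simp [hf])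
    exact (Polynomial.X_pow_sub_one_separable_iff.2 (by exact_mod_cast hN)).squarefree
  have htop : ⨆ μ, f.eigenspace μ = ⊤ := by
    rw [← Module.End.iSup_maxGenEigenspace_eq_top f]
    congr 1
    ext1 μ
    exact (hss.isFinitelySemisimple.maxGenEigenspace_eq_eigenspace μ).symm
  have hint : DirectSum.IsInternal f.eigenspace :=
    DirectSum.isInternal_submodule_of_iSupIndep_of_iSup_eq_top f.eigenspaces_iSupIndep htop
  let B := hint.collectedBasis fun μ => Module.finBasis ℂ (f.eigenspace μ)
  have : Fintype (Σ μ, Fin (Module.finrank ℂ (f.eigenspace μ))) :=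
    Module.Basis.fintypeIndexOfRankLtAleph0 B (Module.rank_lt_aleph0 ℂ V)
  let e := Fintype.equivFin (Σ μ, Fin (Module.finrank ℂ (f.eigenspace μ)))
  refine ⟨_, B.reindex e, fun i => (e.symm i).1, fun i => ?_⟩
  rw [Module.Basis.reindex_apply]
  exact Module.End.mem_eigenspace_iff.1 (hint.collectedBasis_mem _ (e.symm i))

theorem trace_of_eigenbasis {V ι : Type} [AddCommGroup V] [Module ℂ V] [Fintype ι]
    (f : Module.End ℂ V) (b : Module.Basis ι ℂ V) (μ : ι → ℂ) (h : ∀ i, f (b i) = μ i • b i) :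
    LinearMap.trace ℂ V f = ∑ i, μ i := by
  classical
  rw [LinearMap.trace_eq_matrix_trace ℂ b, Matrix.trace]
  refine Finset.sum_congr rfl fun i _ => ?_
  simp [LinearMap.toMatrix_apply, h]

theorem trace_exteriorPower_of_eigenbasis {V : Type} [AddCommGroup V] [Module ℂ V] {d : ℕ}
    (f : Module.End ℂ V) (b : Module.Basis (Fin d) ℂ V) (μ : Fin d → ℂ)
    (h : ∀ i, f (b i) = μ i • b i) (n : ℕ) :
    LinearMap.trace ℂ (⋀[ℂ]^n V) (exteriorPower.map n f) =
      MvPolynomial.aeval μ (MvPolynomial.esymm (Fin d) ℂ n) := by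
  classical
  have : Fintype (Set.powersetCard (Fin d) n) := Fintype.ofFinite _
  rw [trace_of_eigenbasis _ (b.exteriorPower n) (fun s => ∏ i ∈ s.1, μ i)]
  · rw [MvPolynomial.esymm, map_sum]
    simp only [map_prod, MvPolynomial.aeval_X]
    refine Finset.sum_bij (fun s _ => s.1) ?_ ?_ ?_ ?_
    · intro s _
      exact Finset.mem_powersetCard.2 ⟨Finset.subset_univ _, s.2⟩
    · intro s _ t _ hst
      exact Subtype.ext hst
    · intro s hs
      exact ⟨⟨s, (Finset.mem_powersetCard.1 hs).2⟩, Finset.mem_univ _, rfl⟩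
    · intro s _
      rfl
  · intro s
    rw [exteriorPower.basis_apply, exteriorPower.map_apply_ιMulti_family]
    unfold exteriorPower.ιMulti_family
    have : (fun i => f (b i)) ∘ (Set.powersetCard.ofFinEmbEquiv.symm s) =
        fun j => (μ (Set.powersetCard.ofFinEmbEquiv.symm s j)) •
          (b ∘ (Set.powersetCard.ofFinEmbEquiv.symm s)) j := by
      ext j
      simp [h]
    have key : ∏ j, μ (Set.powersetCard.ofFinEmbEquiv.symm s j) = ∏ i ∈ s.1, μ i := by
      rw [← Finset.prod_coe_sort s.1 μ, ← Equiv.prod_comp (s.1.orderIsoOfFin s.2).toEquiv]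
      rfl
    change exteriorPower.ιMulti ℂ n ((fun i => f (b i)) ∘ _) = _
    rw [this, AlternatingMap.map_smul_univ, key]

/-- Newton's identities, for the traces of the exterior powers of an operator of finite order. -/
theorem newton {V : Type} [AddCommGroup V] [Module ℂ V] [FiniteDimensional ℂ V]
    (f : Module.End ℂ V) {N : ℕ} (hN : N ≠ 0) (hf : f ^ N = 1) :
    PowerSeries.X * PowerSeries.derivative ℂ
        (PowerSeries.mk fun n => LinearMap.trace ℂ (⋀[ℂ]^n V) (exteriorPower.map n f)) =
      (PowerSeries.mk fun n => LinearMap.trace ℂ (⋀[ℂ]^n V) (exteriorPower.map n f)) *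
        altSeries (fun k => LinearMap.trace ℂ V (f ^ k)) := by
  obtain ⟨d, b, μ, h⟩ := exists_eigenbasis f hN hf
  have hpow : ∀ (k : ℕ) (i), (f ^ k) (b i) = μ i ^ k • b i := by
    intro k i
    induction k with
    | zero => simp
    | succ k ih => rw [pow_succ', Module.End.mul_apply, ih, map_smul, h, smul_smul, pow_succ]
  have htr : ∀ k, LinearMap.trace ℂ V (f ^ k) =
      MvPolynomial.aeval μ (MvPolynomial.psum (Fin d) ℂ k) := by
    intro k
    rw [trace_of_eigenbasis _ b _ (hpow k)]
    simp [MvPolynomial.psum]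
  ext n
  simp only [trace_exteriorPower_of_eigenbasis f b μ h, htr]
  have hN := congrArg (MvPolynomial.aeval μ) (MvPolynomial.mul_esymm_eq_sum (Fin d) ℂ n)
  simp only [map_mul, map_natCast, map_pow, map_neg, map_one, map_sum] at hN
  have hL : PowerSeries.coeff n (PowerSeries.X * PowerSeries.derivative ℂ
      (PowerSeries.mk fun n => MvPolynomial.aeval μ (MvPolynomial.esymm (Fin d) ℂ n))) =
      n * MvPolynomial.aeval μ (MvPolynomial.esymm (Fin d) ℂ n) := by
    cases n with
    | zero => simp
    | succ n =>
      rw [PowerSeries.coeff_succ_X_mul, PowerSeries.coeff_derivative, PowerSeries.coeff_mk]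
      push_cast
      ring
  rw [hL, hN, PowerSeries.coeff_mul, Finset.mul_sum, Finset.sum_filter]
  simp only [altSeries, PowerSeries.coeff_mk]
  refine Finset.sum_congr rfl fun a ha => ?_
  have hab := Finset.HasAntidiagonal.mem_antidiagonal.1 ha
  by_cases h0 : a.2 = 0
  · have : ¬ a.1 < n := by omega
    simp [h0, this]
  · have h1 : a.1 < n := by omega
    rw [if_pos h1, if_neg h0, ← hab]
    have : ((-1 : ℂ) ^ (a.1 + a.2 + 1)) * (-1) ^ a.1 = (-1) ^ (a.2 + 1) := by
      rw [← pow_add, show a.1 + a.2 + 1 + a.1 = 2 * a.1 + (a.2 + 1) by ring, pow_add, pow_mul]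
      simp
    rw [← this]
    ring

theorem trace_exteriorPower_zero {V : Type} [AddCommGroup V] [Module ℂ V] [FiniteDimensional ℂ V]
    (f : Module.End ℂ V) {N : ℕ} (hN : N ≠ 0) (hf : f ^ N = 1) :
    LinearMap.trace ℂ (⋀[ℂ]^0 V) (exteriorPower.map 0 f) = 1 := by
  obtain ⟨d, b, μ, h⟩ := exists_eigenbasis f hN hf
  rw [trace_exteriorPower_of_eigenbasis f b μ h]
  simp

theorem series_unique {P s t : PowerSeries ℂ} (hP : PowerSeries.coeff 0 P = 0)
    (hs : PowerSeries.X * PowerSeries.derivative ℂ s = s * P)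
    (ht : PowerSeries.X * PowerSeries.derivative ℂ t = t * P)
    (h0 : PowerSeries.coeff 0 s = PowerSeries.coeff 0 t) : s = t := by
  have hrec : ∀ u : PowerSeries ℂ, PowerSeries.X * PowerSeries.derivative ℂ u = u * P →
      ∀ n : ℕ, ((n : ℂ) + 1) * PowerSeries.coeff (n + 1) u =
        ∑ a ∈ Finset.HasAntidiagonal.antidiagonal (n + 1), PowerSeries.coeff a.1 u * PowerSeries.coeff a.2 P := by
    intro u hu n
    rw [← PowerSeries.coeff_mul, ← hu, PowerSeries.coeff_succ_X_mul,
      PowerSeries.coeff_derivative, mul_comm]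
  ext n
  induction n using Nat.strong_induction_on with
  | _ n ih =>
    cases n with
    | zero => exact h0
    | succ n =>
      have hne : (n : ℂ) + 1 ≠ 0 := by exact_mod_cast n.succ_ne_zero
      refine mul_left_cancel₀ hne ?_
      rw [hrec s hs, hrec t ht]
      refine Finset.sum_congr rfl fun a ha => ?_
      have hab := Finset.HasAntidiagonal.mem_antidiagonal.1 ha
      by_cases h2 : a.2 = 0
      · simp only [h2, hP, mul_zero]
      · rw [ih a.1 (by omega)]

variable {G : Type} [Group G]

/-- `s` is the series `λ_t(x) = λ_t(V) / λ_t(W)`, where `x = [V] - [W]`. -/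
def IsLambdaSeries (x : VirtualChar G) (s : PowerSeries (VirtualChar G)) : Prop :=
  ∃ (V W : Type) (_ : AddCommGroup V) (_ : Module ℂ V) (_ : FiniteDimensional ℂ V)
    (_ : AddCommGroup W) (_ : Module ℂ W) (_ : FiniteDimensional ℂ W)
    (ρ : Representation ℂ G V) (σ : Representation ℂ G W),
    x = ofRep ρ - ofRep σ ∧ s * lambdaSeriesRep σ = lambdaSeriesRep ρ

/-- Evaluation of virtual characters at `g`. -/
def evalAt (g : G) : VirtualChar G →+* ℂ :=
  (Pi.evalRingHom (fun _ : G => ℂ) g).comp (VirtualChar G).subtype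

theorem map_lambdaSeriesRep {V : Type} [AddCommGroup V] [Module ℂ V] [FiniteDimensional ℂ V]
    (ρ : Representation ℂ G V) (g : G) :
    PowerSeries.map (evalAt g) (lambdaSeriesRep ρ) =
      PowerSeries.mk fun n => LinearMap.trace ℂ (⋀[ℂ]^n V) (exteriorPower.map n (ρ g)) := by
  ext n
  rw [PowerSeries.coeff_map, lambdaSeriesRep, PowerSeries.coeff_mk, PowerSeries.coeff_mk]
  rfl

theorem rep_pow_card {V : Type} [AddCommGroup V] [Module ℂ V] (ρ : Representation ℂ G V) (g : G) :
    (ρ g) ^ Nat.card G = 1 := by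
  rw [← map_pow, pow_card_eq_one', map_one]

variable [Finite G]

theorem coeff_zero_lambdaSeriesRep {V : Type} [AddCommGroup V] [Module ℂ V]
    [FiniteDimensional ℂ V] (ρ : Representation ℂ G V) :
    PowerSeries.coeff 0 (lambdaSeriesRep ρ) = 1 := by
  refine Subtype.ext (funext fun g => ?_)
  rw [lambdaSeriesRep, PowerSeries.coeff_mk]
  exact trace_exteriorPower_zero (ρ g) Nat.card_pos.ne' (rep_pow_card ρ g)

theorem IsLambdaSeries.coeff_zero {x : VirtualChar G} {s : PowerSeries (VirtualChar G)}
    (h : IsLambdaSeries x s) : PowerSeries.coeff 0 s = 1 := by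
  obtain ⟨V, W, _, _, _, _, _, _, ρ, σ, -, hs⟩ := h
  have := congrArg (PowerSeries.coeff 0) hs
  simpa [PowerSeries.coeff_mul, coeff_zero_lambdaSeriesRep] using this

theorem IsLambdaSeries.ode {x : VirtualChar G} {s : PowerSeries (VirtualChar G)}
    (h : IsLambdaSeries x s) (g : G) :
    PowerSeries.X * PowerSeries.derivative ℂ (PowerSeries.map (evalAt g) s) =
      PowerSeries.map (evalAt g) s * altSeries (fun k => x.1 (g ^ k)) := by
  obtain ⟨V, W, _, _, _, _, _, _, ρ, σ, hx, hs⟩ := h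
  have h1 := newton (ρ g) Nat.card_pos.ne' (rep_pow_card ρ g)
  have h2 := newton (σ g) Nat.card_pos.ne' (rep_pow_card σ g)
  have h3 := congrArg (PowerSeries.map (evalAt g)) hs
  have hc := coeff_zero_lambdaSeriesRep σ
  have hc' := congrArg (evalAt g) hc
  rw [map_one, ← PowerSeries.coeff_map] at hc'
  rw [map_mul] at h3
  rw [← map_lambdaSeriesRep, ← h3] at h1
  rw [← map_lambdaSeriesRep] at h2
  have hP : altSeries (fun k => x.1 (g ^ k)) =
      altSeries (fun k => LinearMap.trace ℂ V (ρ g ^ k)) -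
        altSeries (fun k => LinearMap.trace ℂ W (σ g ^ k)) := by
    ext k
    rw [map_sub]
    simp only [altSeries, PowerSeries.coeff_mk, hx, ← map_pow]
    split_ifs
    · simp
    · rw [← mul_sub]
      rfl
  have hne : PowerSeries.map (evalAt g) (lambdaSeriesRep σ) ≠ 0 := by
    intro h0
    rw [h0] at hc'
    simp at hc'
  refine mul_right_cancel₀ hne ?_
  rw [Derivation.leibniz, smul_eq_mul, smul_eq_mul] at h1
  rw [hP]
  linear_combination h1 - PowerSeries.map (evalAt g) s * h2

/-- The `λ`-series of a virtual character exists and does not depend on the way in which it is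
written as a difference of characters. -/
theorem existsUnique_isLambdaSeries (x : VirtualChar G) : ∃! s, IsLambdaSeries x s := by
  obtain ⟨V, W, _, _, _, _, _, _, ρ, σ, hx⟩ := exists_eq_ofRep_sub x
  refine ⟨lambdaSeriesRep ρ * PowerSeries.invOfUnit (lambdaSeriesRep σ) 1,
    ⟨V, W, _, _, ‹_›, _, _, ‹_›, ρ, σ, hx, ?_⟩, ?_⟩
  · rw [mul_assoc, mul_comm (PowerSeries.invOfUnit _ _), PowerSeries.mul_invOfUnit, mul_one]
    rw [← PowerSeries.coeff_zero_eq_constantCoeff_apply, coeff_zero_lambdaSeriesRep, Units.val_one]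
  · rintro t ht
    have hs : IsLambdaSeries x (lambdaSeriesRep ρ *
        PowerSeries.invOfUnit (lambdaSeriesRep σ) 1) := by
      refine ⟨V, W, _, _, ‹_›, _, _, ‹_›, ρ, σ, hx, ?_⟩
      rw [mul_assoc, mul_comm (PowerSeries.invOfUnit _ _), PowerSeries.mul_invOfUnit, mul_one]
      rw [← PowerSeries.coeff_zero_eq_constantCoeff_apply, coeff_zero_lambdaSeriesRep,
        Units.val_one]
    have hmap : ∀ g, PowerSeries.map (evalAt g) t = PowerSeries.map (evalAt g) _ := fun g =>
      series_unique (by simp [altSeries]) (ht.ode g) (hs.ode g)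
        (by rw [PowerSeries.coeff_map, PowerSeries.coeff_map, ht.coeff_zero, hs.coeff_zero])
    ext n : 1
    refine Subtype.ext (funext fun g => ?_)
    have := congrArg (PowerSeries.coeff n) (hmap g)
    rw [PowerSeries.coeff_map, PowerSeries.coeff_map] at this
    exact this

/-- The total `λ`-operation `λ_t(x) = ∑ λⁿ(x) tⁿ` on `R(G)`, with `λ_t(V - W) = λ_t(V) / λ_t(W)`. -/
def lambdaSeries (x : VirtualChar G) : PowerSeries (VirtualChar G) :=
  (existsUnique_isLambdaSeries x).choose

theorem lambdaSeries_spec (x : VirtualChar G) : IsLambdaSeries x (lambdaSeries x) :=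
  (existsUnique_isLambdaSeries x).choose_spec.1

/-- The operation `λⁿ` on `R(G)`. -/
def lambdaOp (n : ℕ) (x : VirtualChar G) : VirtualChar G :=
  PowerSeries.coeff n (lambdaSeries x)

theorem lambdaOp_ofRep {V : Type} [AddCommGroup V] [Module ℂ V] [FiniteDimensional ℂ V]
    (ρ : Representation ℂ G V) (n : ℕ) : lambdaOp n (ofRep ρ) = ofRep (extPower ρ n) := by
  have h : IsLambdaSeries (ofRep ρ) (lambdaSeriesRep ρ) := by
    refine ⟨V, PUnit, _, _, ‹_›, _, _, inferInstance, ρ, Representation.trivial ℂ G PUnit, ?_, ?_⟩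
    · refine Subtype.ext (funext fun g => ?_)
      have : (Representation.trivial ℂ G PUnit) g = 0 := Subsingleton.elim _ _
      simp [ofRep, character, this]
    · have : lambdaSeriesRep (Representation.trivial ℂ G PUnit) = 1 := by
        ext n : 1
        cases n with
        | zero => rw [coeff_zero_lambdaSeriesRep]; simp
        | succ n =>
          have : Subsingleton (⋀[ℂ]^(n + 1) PUnit) := by
            refine (Module.finrank_zero_iff (R := ℂ)).1 ?_
            rw [exteriorPower.finrank_eq, Module.finrank_zero_of_subsingleton]
            rfl
          refine Subtype.ext (funext fun g => ?_)
          have h0 : extPower (Representation.trivial ℂ G PUnit) (n + 1) g = 0 :=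
            Subsingleton.elim _ _
          simp [lambdaSeriesRep, PowerSeries.coeff_one, ofRep, character, h0]
      rw [this, mul_one]
  rw [lambdaOp, (existsUnique_isLambdaSeries _).unique (lambdaSeries_spec _) h, lambdaSeriesRep,
    PowerSeries.coeff_mk]

/-- The operation `γⁿ(x) = λⁿ(x + n - 1)` on `R(G)`. -/
def gammaOp (n : ℕ) (x : VirtualChar G) : VirtualChar G :=
  lambdaOp n (x + (n : VirtualChar G) - 1)

variable (G) in
/-- The Grothendieck filtration: `Γⁿ(G)` is the additive subgroup of `R(G)` generated by the
monomials `γ^{n₁}(x₁) ⋯ γ^{n_k}(x_k)` with `x_i` in the augmentation ideal and `∑ n_i ≥ n`. -/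
def grothendieckFiltration (n : ℕ) : AddSubgroup (VirtualChar G) :=
  AddSubgroup.closure {y | ∃ l : List (ℕ × VirtualChar G),
    (∀ q ∈ l, q.2 ∈ RingHom.ker (augmentation G)) ∧ n ≤ (l.map Prod.fst).sum ∧
      y = (l.map fun q => gammaOp q.1 q.2).prod}

end Lambda

/-! ### Induction and the saturated filtration -/

section Induction

variable {G : Type} [Group G] [Finite G] (H : Subgroup G)

open scoped Classical in
/-- The induced class function,
`(Ind f)(g) = |H|⁻¹ ∑_{x ∈ G, x g x⁻¹ ∈ H} f(x g x⁻¹)`. -/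
def indFun (f : H → ℂ) (g : G) : ℂ :=
  (Nat.card H : ℂ)⁻¹ * ∑ᶠ x : G, if h : x * g * x⁻¹ ∈ H then f ⟨x * g * x⁻¹, h⟩ else 0

theorem indFun_sub (f f' : H → ℂ) : indFun H (f - f') = indFun H f - indFun H f' := by
  classical
  have := Fintype.ofFinite G
  ext g
  simp only [indFun, Pi.sub_apply, finsum_eq_sum_of_fintype, ← mul_sub, ← Finset.sum_sub_distrib]
  congr 1
  refine Finset.sum_congr rfl fun x _ => ?_
  split_ifs <;> simp

theorem indFun_add (f f' : H → ℂ) : indFun H (f + f') = indFun H f + indFun H f' := by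
  classical
  have := Fintype.ofFinite G
  ext g
  simp only [indFun, Pi.add_apply, finsum_eq_sum_of_fintype, ← mul_add, ← Finset.sum_add_distrib]
  congr 1
  refine Finset.sum_congr rfl fun x _ => ?_
  split_ifs <;> simp

/-- The trace on coinvariants is an average of traces. -/
theorem trace_coinvariants {K M : Type} [Group K] [Fintype K] [AddCommGroup M] [Module ℂ M]
    [FiniteDimensional ℂ M] (τ : Representation ℂ K M) (T : Module.End ℂ M)
    (T' : Module.End ℂ τ.Coinvariants) (hT : T' ∘ₗ Coinvariants.mk τ = Coinvariants.mk τ ∘ₗ T) :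
    LinearMap.trace ℂ _ T' =
      (Fintype.card K : ℂ)⁻¹ * ∑ h : K, LinearMap.trace ℂ M (T * τ h) := by
  have hc : (Fintype.card K : ℂ) ≠ 0 := by exact_mod_cast Fintype.card_ne_zero
  let A : Module.End ℂ M := (Fintype.card K : ℂ)⁻¹ • ∑ h : K, τ h
  have hA : ∀ x : K, A ∘ₗ τ x = A := by
    intro x
    change A * τ x = A
    simp only [A, smul_mul_assoc, Finset.sum_mul, ← map_mul]
    congr 1
    exact Fintype.sum_equiv (Equiv.mulRight x) _ _ fun _ => rfl
  let s : τ.Coinvariants →ₗ[ℂ] M := Coinvariants.lift τ A hA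
  have hs : Coinvariants.mk τ ∘ₗ s = LinearMap.id := by
    refine Coinvariants.hom_ext (LinearMap.ext fun v => ?_)
    simp only [LinearMap.comp_apply, s, Coinvariants.lift_mk, LinearMap.id_apply]
    simp only [A, LinearMap.smul_apply, LinearMap.sum_apply, map_smul, map_sum,
      Coinvariants.mk_self_apply, Finset.sum_const, Finset.card_univ]
    rw [← Nat.cast_smul_eq_nsmul ℂ, smul_smul, inv_mul_cancel₀ hc, one_smul]
  have h1 : T' = Coinvariants.mk τ ∘ₗ (T ∘ₗ s) := by
    rw [← LinearMap.comp_assoc, ← hT, LinearMap.comp_assoc, hs, LinearMap.comp_id]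
  have h2 : (T ∘ₗ s) ∘ₗ Coinvariants.mk τ = T * A := rfl
  rw [h1, LinearMap.trace_comp_comm', h2]
  simp only [A, mul_smul_comm, Finset.mul_sum, map_smul, map_sum, smul_eq_mul]

/-- The formula for induced class functions gives the character of the induced representation. -/
theorem indFun_character {V : Type} [AddCommGroup V] [Module ℂ V] [FiniteDimensional ℂ V]
    (ρ : Representation ℂ H V) :
    indFun H ρ.character = (Representation.ind H.subtype ρ).character := by
  classical
  have := Fintype.ofFinite G
  ext g
  let τ : Representation ℂ H (TensorProduct ℂ (MonoidAlgebra ℂ G) V) :=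
    Representation.tprod ((leftRegular ℂ G).comp H.subtype) ρ
  let P : Module.End ℂ (MonoidAlgebra ℂ G) :=
    MonoidAlgebra.mapDomainLinearMap ℂ ℂ fun x : G => x * g⁻¹
  have : Module.Finite ℂ (MonoidAlgebra ℂ G) :=
    Module.Finite.of_basis (MonoidAlgebra.basis G ℂ)
  have h1 := trace_coinvariants τ (P.rTensor V) (Representation.ind H.subtype ρ g) rfl
  have h2 : ∀ h : H, LinearMap.trace ℂ _ (P.rTensor V * τ h) =
      ∑ x : G, if x * g * x⁻¹ = (h : G) then ρ.character h else 0 := by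
    intro h
    have h3 : P.rTensor V * τ h =
        TensorProduct.map (P * leftRegular ℂ G (h : G)) (ρ h) := by
      refine TensorProduct.ext' fun a v => ?_
      rfl
    rw [h3, LinearMap.trace_tensorProduct', LinearMap.trace_eq_matrix_trace ℂ
      (MonoidAlgebra.basis G ℂ), Matrix.trace, Finset.sum_mul]
    refine Finset.sum_congr rfl fun x _ => ?_
    have h4 : (h : G) * x * g⁻¹ = x ↔ x * g * x⁻¹ = (h : G) := by
      rw [mul_inv_eq_iff_eq_mul, mul_inv_eq_iff_eq_mul, eq_comm]
    simp [LinearMap.toMatrix_apply, P, character, MonoidAlgebra.basis, Finsupp.single_apply, h4]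
  rw [character, h1]
  simp only [h2, indFun, finsum_eq_sum_of_fintype, Nat.card_eq_fintype_card]
  rw [Finset.sum_comm]
  congr 1
  refine Finset.sum_congr rfl fun x _ => ?_
  split_ifs with hx
  · rw [Finset.sum_eq_single (⟨x * g * x⁻¹, hx⟩ : H)]
    · simp
    · intro b _ hb
      rw [if_neg]
      intro hb'
      exact hb (Subtype.ext hb'.symm)
    · simp
  · refine (Finset.sum_eq_zero fun b _ => ?_).symm
    rw [if_neg]
    intro hb
    exact hx (hb ▸ b.2)

theorem indFun_mem {f : H → ℂ} (hf : f ∈ VirtualChar H) : indFun H f ∈ VirtualChar G := by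
  obtain ⟨_, _, ⟨V, _, _, _, ρ, rfl⟩, ⟨W, _, _, _, σ, rfl⟩, rfl⟩ := hf
  rw [indFun_sub, indFun_character, indFun_character]
  exact ⟨_, _, isCharacter_character _, isCharacter_character _, rfl⟩

/-- Induction of virtual characters `R(H) → R(G)`. -/
def induction : VirtualChar H →+ VirtualChar G :=
  AddMonoidHom.mk' (fun f => ⟨indFun H f.1, indFun_mem H f.2⟩)
    fun f f' => Subtype.ext (indFun_add H f.1 f'.1)

theorem induction_ofRep {V : Type} [AddCommGroup V] [Module ℂ V] [FiniteDimensional ℂ V]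
    (ρ : Representation ℂ H V) :
    induction H (ofRep ρ) = ofRep (Representation.ind H.subtype ρ) :=
  Subtype.ext (indFun_character H ρ)

variable (G) in
/-- The saturated filtration `Fⁿ(G) = ∑_{H ≤ G} Ind_H^G Γⁿ(H)`. -/
def saturatedFiltration (n : ℕ) : AddSubgroup (VirtualChar G) :=
  ⨆ H : Subgroup G, (grothendieckFiltration H n).map (induction H)

variable (G) in
/-- `G` is saturated: its Grothendieck and saturated filtrations coincide. -/
def IsSaturated : Prop :=
  ∀ n : ℕ, saturatedFiltration G n = grothendieckFiltration G n

/-- Induction from `H` preserves the Grothendieck filtrations. -/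
def IsGammaCompatible : Prop :=
  ∀ n : ℕ, (grothendieckFiltration H n).map (induction H) ≤ grothendieckFiltration G n

end Induction

end CharacterRing

end

noncomputable section

namespace CharacterRing

open Representation PowerSeries

/-! ### The `λ`-operations: additivity and naturality -/

section LambdaSeries

variable {G K : Type} [Group G] [Group K]

/-! Every proper subgroup of these groups is cyclic, and induction from the whole group is the
identity, so everything rests on cyclic `H ≤ G`. Let `χ` be a faithful linear character of `H`. Its
powers span `R(H)`, `γ_t` turns sums into products, and `γ_t(χ^j - 1) = 1 + (χ^j - 1)t`, so `γⁿ(x)`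
is divisible by `(χ - 1)ⁿ` for all `x` of degree zero. Hence `Γⁿ(H) ⊆ (χ - 1)ⁿ R(H)`
(`dvd_of_mem_grothendieckFiltration`).

Suppose some `v ∈ R(G)` restricts to `χ + χ⁻¹`. Then `c = γ²(v - 2)` restricts to `(χ - 1)(χ⁻¹ -
1)`, so that `(χ - 1)² = -χ · res c`. The projection formula gives `Ind((χ - 1)^(2k) y) = c^k ·
Ind((-χ)^k y)`, which lies in `Γ^(2k)(G)`. If `y` has degree zero, so does the induced factor, and
the product lies in `Γ^(2k+1)(G)`. This is `isGammaCompatible_of_faithful`.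

Such a `v` comes from a two-dimensional representation of `G` that is faithful with determinant one
on `H`: the irreducible one for `Q₈`, the standard one for rotations in `D_p`, and twice the sign
for subgroups generated by a reflection. -/

theorem evalAt_apply (g : G) (x : VirtualChar G) : evalAt g x = x.1 g := rfl

theorem ext_evalAt {x y : VirtualChar G} (h : ∀ g, evalAt g x = evalAt g y) : x = y :=
  Subtype.ext (funext h)

/-- Restriction of virtual characters along a group homomorphism. -/
def res (f : K →* G) : VirtualChar G →+* VirtualChar K where
  toFun x := ⟨fun k => x.1 (f k), by
    obtain ⟨_, _, _, ⟨V, _, _, _, ρ, rfl⟩, ⟨W, _, _, _, σ, rfl⟩, rfl⟩ := x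
    exact ⟨_, _, isCharacter_character (ρ.comp f), isCharacter_character (σ.comp f), rfl⟩⟩
  map_one' := rfl
  map_mul' _ _ := rfl
  map_zero' := rfl
  map_add' _ _ := rfl

theorem evalAt_res (f : K →* G) (x : VirtualChar G) (k : K) :
    evalAt k (res f x) = evalAt (f k) x := rfl

theorem augmentation_eq_evalAt (x : VirtualChar G) : augmentation G x = evalAt 1 x := rfl

theorem augmentation_res (f : K →* G) (x : VirtualChar G) :
    augmentation K (res f x) = augmentation G x := by
  rw [augmentation_eq_evalAt, augmentation_eq_evalAt, evalAt_res, map_one]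

/-- The augmentation takes values in `ℂ`; integrality allows subtracting the degree inside `R(G)`.
-/
theorem exists_augmentation_eq_intCast (x : VirtualChar G) : ∃ m : ℤ, augmentation G x = m := by
  obtain ⟨V, W, _, _, _, _, _, _, ρ, σ, rfl⟩ := exists_eq_ofRep_sub x
  exact ⟨Module.finrank ℂ V - Module.finrank ℂ W, by simp [augmentation_ofRep]⟩

theorem evalAt_conj (g x : G) (z : VirtualChar G) : evalAt (x * g * x⁻¹) z = evalAt g z := by
  obtain ⟨V, W, _, _, _, _, _, _, ρ, σ, rfl⟩ := exists_eq_ofRep_sub z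
  rw [map_sub, map_sub]
  exact congrArg₂ _ (char_conj ρ g x) (char_conj σ g x)

theorem altSeries_add (p q : ℕ → ℂ) :
    altSeries (fun k => p k + q k) = altSeries p + altSeries q := by
  ext k
  simp only [altSeries, coeff_mk, map_add]
  split_ifs <;> ring

variable [Finite G] [Finite K]

/-- The `λ`-series is determined by its constant term and Newton's identities. -/
theorem lambdaSeries_eq {x : VirtualChar G} {s : PowerSeries (VirtualChar G)}
    (h0 : coeff 0 s = 1)
    (h : ∀ g, X * derivative ℂ (map (evalAt g) s) =
      map (evalAt g) s * altSeries (fun k => evalAt (g ^ k) x)) :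
    lambdaSeries x = s := by
  have hx := lambdaSeries_spec x
  ext n : 1
  refine ext_evalAt fun g => ?_
  rw [← coeff_map, ← coeff_map]
  congr 1
  exact series_unique (by simp [altSeries]) (hx.ode g) (h g)
    (by rw [coeff_map, coeff_map, hx.coeff_zero, h0])

/-- Newton's identities prescribe the logarithmic derivative of the `λ`-series at each `g`, and this
prescription is additive in the virtual character. -/
theorem lambdaSeries_add (x y : VirtualChar G) :
    lambdaSeries (x + y) = lambdaSeries x * lambdaSeries y := by
  have hx := lambdaSeries_spec x
  have hy := lambdaSeries_spec y
  refine lambdaSeries_eq ?_ fun g => ?_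
  · have h1 := hx.coeff_zero
    have h2 := hy.coeff_zero
    rw [coeff_zero_eq_constantCoeff_apply] at *
    rw [map_mul, h1, h2, one_mul]
  · have h1 := hx.ode g
    have h2 := hy.ode g
    simp only [map_add, altSeries_add, map_mul, Derivation.leibniz, smul_eq_mul, evalAt_apply]
    linear_combination map (evalAt g) (lambdaSeries y) * h1 + map (evalAt g) (lambdaSeries x) * h2

theorem lambdaSeries_zero : lambdaSeries (0 : VirtualChar G) = 1 := by
  refine lambdaSeries_eq (by simp) fun g => ?_
  have : altSeries (fun _ => 0) = 0 := by
    ext k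
    simp [altSeries]
  simp [this]

/-- With `c = x(g)`, the alternating power-sum series is `cX / (1 + cX)`, the logarithmic derivative
(times `X`) of `1 + cX`. -/
theorem lambdaSeries_of_multiplicative {x : VirtualChar G}
    (h : ∀ g (k : ℕ), evalAt (g ^ k) x = evalAt g x ^ k) :
    lambdaSeries x = 1 + C x * X := by
  refine lambdaSeries_eq (by simp) fun g => ?_
  simp only [h, map_add, map_one, map_mul, map_C, map_X, Derivation.leibniz, smul_eq_mul]
  have hd : derivative ℂ (C (evalAt g x)) = 0 := derivative_C
  have hX : derivative ℂ (X : PowerSeries ℂ) = 1 := derivative_X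
  rw [hd, hX, Derivation.map_one_eq_zero]
  -- The vanishing constant term of `altSeries` makes degrees 0 and 1 special; from degree 2 on,
  -- consecutive terms cancel.
  ext n
  match n with
  | 0 => simp [altSeries]
  | 1 =>
    rw [add_mul, mul_assoc, map_add, coeff_C_mul, coeff_succ_X_mul]
    simp [altSeries, mul_comm X]
  | n + 2 =>
    rw [add_mul, mul_assoc, map_add, coeff_C_mul, coeff_succ_X_mul]
    simp [altSeries, mul_comm X]
    ring

theorem lambdaSeries_natCast (n : ℕ) : lambdaSeries (n : VirtualChar G) = (1 + X) ^ n := by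
  induction n with
  | zero => rw [Nat.cast_zero, lambdaSeries_zero, pow_zero]
  | succ n ih =>
    rw [Nat.cast_succ, lambdaSeries_add, ih, pow_succ,
      lambdaSeries_of_multiplicative (x := 1) (by simp), map_one, one_mul]

/-- Newton's identities for the restriction at `k` are those for `x` at `f k`. -/
theorem lambdaSeries_res (f : K →* G) (x : VirtualChar G) :
    lambdaSeries (res f x) = map (res f) (lambdaSeries x) := by
  have hx := lambdaSeries_spec x
  refine lambdaSeries_eq (by rw [coeff_map, hx.coeff_zero, map_one]) fun k => ?_
  have h : map (evalAt k) (map (res f) (lambdaSeries x)) = map (evalAt (f k)) (lambdaSeries x) := by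
    ext n
    simp only [coeff_map, evalAt_res]
  rw [h]
  convert hx.ode (f k) using 4
  rw [evalAt_res, map_pow]
  rfl

theorem lambdaOp_res (f : K →* G) (n : ℕ) (x : VirtualChar G) :
    lambdaOp n (res f x) = res f (lambdaOp n x) := by
  rw [lambdaOp, lambdaSeries_res, coeff_map, lambdaOp]

theorem gammaOp_res (f : K →* G) (n : ℕ) (x : VirtualChar G) :
    gammaOp n (res f x) = res f (gammaOp n x) := by
  rw [gammaOp, gammaOp, ← lambdaOp_res]
  simp

theorem map_res_grothendieckFiltration_le (f : K →* G) (n : ℕ) :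
    (grothendieckFiltration G n).map (res f : VirtualChar G →+ VirtualChar K) ≤
      grothendieckFiltration K n := by
  rw [grothendieckFiltration, AddMonoidHom.map_closure, AddSubgroup.closure_le]
  rintro _ ⟨_, ⟨l, hl, hn, rfl⟩, rfl⟩
  refine AddSubgroup.subset_closure ⟨l.map (Prod.map id (res f)), ?_, ?_, ?_⟩
  · intro q hq
    obtain ⟨q, hq', rfl⟩ := List.mem_map.1 hq
    have := hl q hq'
    rw [RingHom.mem_ker] at this ⊢
    exact (augmentation_res f q.2).trans this
  · simpa [Function.comp_def] using hn
  · simp [Function.comp_def, map_list_prod, gammaOp_res]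

end LambdaSeries

/-! ### The series `γ_t` as `λ_{t/(1-t)}` -/

section GammaSeries

/-- The power series `X / (1 - X)`. -/
def geomShift (R : Type) [CommRing R] : PowerSeries R := X * mk 1

theorem hasSubst_geomShift (R : Type) [CommRing R] : HasSubst (geomShift R) :=
  HasSubst.of_constantCoeff_zero' (by simp [geomShift])

theorem one_add_geomShift_mul (R : Type) [CommRing R] : (1 + geomShift R) * (1 - X) = 1 := by
  have h : (mk 1 : PowerSeries R) * (1 - X) = 1 := mk_one_mul_one_sub_eq_one R
  rw [geomShift]
  linear_combination X * h

/-- Both sides equal `∑ a_d · C(n, d - 1)` over `1 ≤ d ≤ n + 1`, by the symmetry of binomial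
coefficients. The factor `(1 + X)^n` is `λ_t(n)`, matching `γ^(n+1)(x) = λ^(n+1)(x + n)`. -/
theorem coeff_subst_geomShift {R : Type} [CommRing R] (A : PowerSeries R) (n : ℕ) :
    coeff (n + 1) (A.subst (geomShift R)) = coeff (n + 1) (A * (1 + X) ^ n) := by
  have hpow : ∀ d e : ℕ, coeff e (geomShift R ^ (d + 1)) =
      if d + 1 ≤ e then ((e - 1).choose d : R) else 0 := by
    intro d e
    rw [geomShift, mul_pow, mk_one_pow_eq_mk_choose_add, coeff_X_pow_mul']
    split_ifs with h
    · rw [coeff_mk]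
      congr 2
      omega
    · rfl
  rw [coeff_subst' (hasSubst_geomShift R), coeff_mul,
    Finset.Nat.sum_antidiagonal_eq_sum_range_succ_mk,
    finsum_eq_sum_of_support_subset (s := Finset.range (n + 1).succ)]
  · refine Finset.sum_congr rfl fun d hd => ?_
    have hd : d ≤ n + 1 := Nat.lt_succ_iff.1 (Finset.mem_range.1 hd)
    have h1 : coeff (n + 1 - d) ((1 + X : PowerSeries R) ^ n) = (n.choose (n + 1 - d) : R) := by
      have := Polynomial.coeff_one_add_X_pow R n (n + 1 - d)
      rw [← this, ← Polynomial.coeff_coe]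
      simp
    rw [smul_eq_mul, h1]
    congr 1
    cases d with
    | zero => simp
    | succ d =>
      rw [hpow, if_pos hd, Nat.add_sub_cancel, Nat.add_sub_add_right, Nat.choose_symm (by omega)]
  · intro d hd
    by_contra hlt
    have : n + 1 < d := by simpa using hlt
    obtain ⟨d, rfl⟩ : ∃ e, d = e + 1 := ⟨d - 1, by omega⟩
    refine hd ?_
    dsimp only
    rw [hpow, if_neg (by omega), smul_zero]

variable {G : Type} [Group G] [Finite G]

/-- The series `γ_t(x) = ∑ γⁿ(x) tⁿ`. -/
def gammaSeries (x : VirtualChar G) : PowerSeries (VirtualChar G) :=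
  PowerSeries.mk fun n => gammaOp n x

theorem gammaOp_eq_coeff (n : ℕ) (x : VirtualChar G) : gammaOp n x = coeff n (gammaSeries x) := by
  rw [gammaSeries, coeff_mk]

theorem gammaOp_zero (x : VirtualChar G) : gammaOp 0 x = 1 := by
  rw [gammaOp, lambdaOp, (lambdaSeries_spec _).coeff_zero]

/-- Since substitution is a ring homomorphism, `γ_t` inherits from `λ_t` the conversion of sums into
products. -/
theorem gammaSeries_eq_subst (x : VirtualChar G) :
    gammaSeries x = (lambdaSeries x).subst (geomShift (VirtualChar G)) := by
  ext n : 1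
  rw [gammaSeries, coeff_mk]
  cases n with
  | zero =>
    rw [gammaOp_zero, coeff_subst' (hasSubst_geomShift _), finsum_eq_single _ 0,
      (lambdaSeries_spec x).coeff_zero]
    · simp
    · intro d hd
      simp [geomShift, hd]
  | succ n =>
    rw [coeff_subst_geomShift, ← lambdaSeries_natCast, ← lambdaSeries_add, gammaOp, lambdaOp]
    congr 2
    push_cast
    ring

theorem gammaSeries_add (x y : VirtualChar G) :
    gammaSeries (x + y) = gammaSeries x * gammaSeries y := by
  rw [gammaSeries_eq_subst, gammaSeries_eq_subst, gammaSeries_eq_subst, lambdaSeries_add,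
    subst_mul (hasSubst_geomShift _)]

theorem gammaSeries_zero : gammaSeries (0 : VirtualChar G) = 1 := by
  rw [gammaSeries_eq_subst, lambdaSeries_zero, ← coe_substAlgHom (hasSubst_geomShift _), map_one]

/-- Divide `γ_t(x) = 1 + x t/(1 - t)` by `γ_t(1) = 1/(1 - t)`. -/
theorem gammaSeries_sub_one {x : VirtualChar G}
    (h : ∀ g (k : ℕ), evalAt (g ^ k) x = evalAt g x ^ k) :
    gammaSeries (x - 1) = 1 + C (x - 1) * X := by
  have key : ∀ {y : VirtualChar G}, (∀ g (k : ℕ), evalAt (g ^ k) y = evalAt g y ^ k) →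
      gammaSeries y = 1 + C y * geomShift (VirtualChar G) := by
    intro y hy
    rw [gammaSeries_eq_subst, lambdaSeries_of_multiplicative hy,
      ← coe_substAlgHom (hasSubst_geomShift _), map_add, map_one, map_mul,
      coe_substAlgHom (hasSubst_geomShift _), subst_X (hasSubst_geomShift _), subst_C]
    rfl
  have h1 := gammaSeries_add (x - 1) 1
  rw [sub_add_cancel, key h, key (y := 1) (by simp), map_one, one_mul] at h1
  have h2 := one_add_geomShift_mul (VirtualChar G)
  rw [map_sub, map_one]
  linear_combination -(1 - X) * h1 + (C x - gammaSeries (x - 1)) * h2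

/-- This is Newton's identity in degree 1; it gives elements of the augmentation ideal weight one in
the filtration. -/
theorem gammaOp_one (x : VirtualChar G) : gammaOp 1 x = x := by
  refine ext_evalAt fun g => ?_
  have h := congrArg (coeff 1) ((lambdaSeries_spec x).ode g)
  have h0 : evalAt g (coeff 0 (lambdaSeries x)) = 1 := by
    rw [(lambdaSeries_spec x).coeff_zero, map_one]
  rw [coeff_succ_X_mul, coeff_derivative, coeff_mul] at h
  simp [Finset.Nat.antidiagonal_succ, altSeries, h0,
    -coeff_zero_eq_constantCoeff] at h
  simpa [gammaOp, lambdaOp, evalAt_apply] using h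

end GammaSeries

/-! ### Monomials in the Grothendieck filtration -/

section Filtration

variable {G : Type} [Group G] [Finite G]

theorem list_prod_mem_grothendieckFiltration (l : List (ℕ × VirtualChar G)) {n : ℕ}
    (hl : ∀ q ∈ l, augmentation G q.2 = 0) (hn : n ≤ (l.map Prod.fst).sum) :
    (l.map fun q => gammaOp q.1 q.2).prod ∈ grothendieckFiltration G n :=
  AddSubgroup.subset_closure ⟨l, hl, hn, rfl⟩

theorem gammaOp_two_pow_mul_mem_odd {w y : VirtualChar G} (hw : augmentation G w = 0)
    (hy : augmentation G y = 0) (k : ℕ) :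
    gammaOp 2 w ^ k * y ∈ grothendieckFiltration G (2 * k + 1) := by
  have h := list_prod_mem_grothendieckFiltration (List.replicate k (2, w) ++ [(1, y)])
    (n := 2 * k + 1) ?_ ?_
  · simpa [gammaOp_one] using h
  · simp only [List.mem_append, List.mem_replicate, List.mem_singleton]
    rintro q (⟨-, rfl⟩ | rfl)
    exacts [hw, hy]
  · simp [mul_comm]

theorem grothendieckFiltration_antitone : Antitone (grothendieckFiltration G) := by
  intro m n hmn
  refine AddSubgroup.closure_mono ?_
  rintro _ ⟨l, hl, hn, rfl⟩
  exact ⟨l, hl, hmn.trans hn, rfl⟩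

/-- Split `y` into a part of degree zero, which even gains one step of filtration, and the integer
`m`. -/
theorem gammaOp_two_pow_mul_mem_even {w : VirtualChar G} (hw : augmentation G w = 0)
    (y : VirtualChar G) (k : ℕ) :
    gammaOp 2 w ^ k * y ∈ grothendieckFiltration G (2 * k) := by
  obtain ⟨m, hm⟩ := exists_augmentation_eq_intCast y
  have h1 : gammaOp 2 w ^ k * (y - m) ∈ grothendieckFiltration G (2 * k) :=
    grothendieckFiltration_antitone (Nat.le_succ _)
      (gammaOp_two_pow_mul_mem_odd hw (by simp [hm]) k)
  have h2 : gammaOp 2 w ^ k ∈ grothendieckFiltration G (2 * k) := by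
    have h := list_prod_mem_grothendieckFiltration (List.replicate k (2, w)) (n := 2 * k) ?_ ?_
    · simpa using h
    · simp only [List.mem_replicate]
      rintro q ⟨-, rfl⟩
      exact hw
    · simp [mul_comm]
  have h3 := add_mem h1 (zsmul_mem h2 m)
  rw [zsmul_eq_mul] at h3
  convert h3 using 1
  ring

end Filtration

/-! ### Projection formula and induction from the whole group -/

section Induction

variable {G : Type} [Group G] [Finite G] (H : Subgroup G)

/-- The projection formula. -/
theorem induction_res_mul (z : VirtualChar G) (y : VirtualChar H) :
    induction H (res H.subtype z * y) = z * induction H y := by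
  classical
  have := Fintype.ofFinite G
  refine Subtype.ext (funext fun g => ?_)
  change indFun H (fun h => z.1 h * y.1 h) g = z.1 g * indFun H y.1 g
  rw [indFun, indFun, finsum_eq_sum_of_fintype, finsum_eq_sum_of_fintype, mul_left_comm,
    Finset.mul_sum _ _ (z.1 g)]
  refine congrArg _ (Finset.sum_congr rfl fun x _ => ?_)
  split_ifs with hx
  · exact congrArg (· * _) (evalAt_conj g x z)
  · rw [mul_zero]

/-- Only the value of `y` at the identity enters the induction formula at the identity. -/
theorem augmentation_induction {y : VirtualChar H} (hy : augmentation H y = 0) :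
    augmentation G (induction H y) = 0 := by
  classical
  have := Fintype.ofFinite G
  have hy : y.1 1 = 0 := hy
  change indFun H y.1 1 = 0
  rw [indFun, finsum_eq_sum_of_fintype, Finset.sum_eq_zero, mul_zero]
  intro x _
  have h1 : x * 1 * x⁻¹ = 1 := by simp
  simp only [h1]
  rw [dif_pos H.one_mem]
  exact hy

theorem induction_top_res (z : VirtualChar G) :
    induction (⊤ : Subgroup G) (res (Subgroup.subtype ⊤) z) = z := by
  classical
  have := Fintype.ofFinite G
  have h1 : induction (⊤ : Subgroup G) 1 = 1 := by
    refine Subtype.ext (funext fun g => ?_)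
    change indFun ⊤ 1 g = 1
    simp [indFun, finsum_eq_sum_of_fintype]
  rw [← mul_one (res _ z), induction_res_mul, h1, mul_one]

theorem isGammaCompatible_top : IsGammaCompatible (⊤ : Subgroup G) := by
  rintro n _ ⟨y, hy, rfl⟩
  have h : y = res (Subgroup.subtype ⊤) (res Subgroup.topEquiv.symm.toMonoidHom y) := rfl
  rw [h, induction_top_res]
  exact map_res_grothendieckFiltration_le _ n ⟨y, hy, rfl⟩

/-- The inclusion `Γⁿ ⊆ Fⁿ` always holds, through the summand `H = ⊤`. -/
theorem isSaturated_of_isGammaCompatible (h : ∀ H : Subgroup G, IsGammaCompatible H) :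
    IsSaturated G := by
  intro n
  refine le_antisymm (iSup_le fun H => h H n) fun x hx => ?_
  refine AddSubgroup.mem_iSup_of_mem ⊤ ⟨res (Subgroup.subtype ⊤) x, ?_, induction_top_res x⟩
  exact map_res_grothendieckFiltration_le _ n ⟨x, hx, rfl⟩

end Induction

theorem pow_apply_eigenvector {V : Type} [AddCommGroup V] [Module ℂ V] {f : Module.End ℂ V}
    {v : V} {c : ℂ} (h : f v = c • v) (k : ℕ) : (f ^ k) v = c ^ k • v := by
  induction k with
  | zero => simp
  | succ k ih => rw [pow_succ', Module.End.mul_apply, ih, map_smul, h, smul_smul, pow_succ]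

/-! ### Finite cyclic groups: `Γⁿ` lies in the ideal generated by `(χ - 1)ⁿ` -/

section Linear

variable {H : Type} [Group H]

/-- A homomorphism to `ℂ`, viewed as a character. -/
def ofLinear (χ : H →* ℂ) : VirtualChar H :=
  ⟨χ, IsCharacter.mem ⟨ℂ, inferInstance, inferInstance, inferInstance,
    (Algebra.lmul ℂ ℂ).toMonoidHom.comp χ, by
      ext g
      simp [character, LinearMap.trace_eq_matrix_trace ℂ (Module.Basis.singleton Unit ℂ),
        LinearMap.toMatrix_apply, Matrix.trace]⟩⟩

theorem evalAt_ofLinear (χ : H →* ℂ) (g : H) : evalAt g (ofLinear χ) = χ g := rfl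

theorem augmentation_ofLinear (χ : H →* ℂ) : augmentation H (ofLinear χ) = 1 := map_one χ

theorem evalAt_pow_ofLinear (χ : H →* ℂ) (g : H) (k : ℕ) :
    evalAt (g ^ k) (ofLinear χ) = evalAt g (ofLinear χ) ^ k := map_pow χ g k

theorem ofLinear_pow (χ : H →* ℂ) (j : ℕ) : ofLinear χ ^ j = ofLinear (χ ^ j) := rfl

variable [Finite H]

/-- The virtual characters of a finite cyclic group are the integral combinations of the powers
of a faithful linear character. -/
theorem closure_powers_ofLinear_eq_top [IsCyclic H] {χ : H →* ℂ} (hχ : Function.Injective χ) :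
    AddSubgroup.closure (Set.range fun j : ℕ => ofLinear χ ^ j) = ⊤ := by
  obtain ⟨h, hh⟩ := IsCyclic.exists_generator (α := H)
  have hprim : IsPrimitiveRoot (χ h) (Nat.card H) := by
    rw [← orderOf_eq_card_of_forall_mem_zpowers hh, ← orderOf_injective χ hχ]
    exact IsPrimitiveRoot.orderOf _
  have hrep : ∀ {V : Type} [AddCommGroup V] [Module ℂ V] [FiniteDimensional ℂ V]
      (ρ : Representation ℂ H V),
      ofRep ρ ∈ AddSubgroup.closure (Set.range fun j : ℕ => ofLinear χ ^ j) := by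
    intro V _ _ _ ρ
    obtain ⟨d, b, μ, hb⟩ := exists_eigenbasis (ρ h) Nat.card_pos.ne' (rep_pow_card ρ h)
    have hpow : ∀ (k : ℕ) (i), ((ρ h) ^ k) (b i) = μ i ^ k • b i := fun k i =>
      pow_apply_eigenvector (hb i) k
    -- Eigenvalues of the generator are `|H|`-th roots of unity, hence powers of the primitive root
    -- `χ h`.
    have hμ : ∀ i, ∃ j : ℕ, χ h ^ j = μ i := by
      intro i
      have h1 := hpow (Nat.card H) i
      rw [rep_pow_card, Module.End.one_apply] at h1
      have h2 : μ i ^ Nat.card H = 1 :=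
        smul_left_injective ℂ (b.ne_zero i) (by simpa using h1.symm)
      have : NeZero (Nat.card H) := ⟨Nat.card_pos.ne'⟩
      obtain ⟨j, -, hj⟩ := hprim.eq_pow_of_pow_eq_one h2
      exact ⟨j, hj⟩
    choose j hj using hμ
    have : ofRep ρ = ∑ i, ofLinear χ ^ j i := by
      refine ext_evalAt fun g => ?_
      obtain ⟨k, rfl⟩ := mem_powers_iff_mem_zpowers.2 (hh g)
      have h1 : evalAt (h ^ k) (ofRep ρ) = ∑ i, μ i ^ k := by
        change LinearMap.trace ℂ V (ρ (h ^ k)) = _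
        rw [map_pow, trace_of_eigenbasis _ b _ (hpow k)]
      rw [h1, map_sum]
      refine Finset.sum_congr rfl fun i _ => ?_
      rw [map_pow, evalAt_ofLinear, map_pow, ← hj, pow_right_comm]
    rw [this]
    exact sum_mem fun i _ => AddSubgroup.subset_closure ⟨j i, rfl⟩
  refine eq_top_iff.2 fun x _ => ?_
  obtain ⟨V, W, _, _, _, _, _, _, ρ, σ, rfl⟩ := exists_eq_ofRep_sub x
  exact sub_mem (hrep ρ) (hrep σ)

/-- The virtual characters all of whose `γ`-operations `γⁿ` are divisible by `aⁿ`. -/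
def gammaDvd (a : VirtualChar H) : AddSubgroup (VirtualChar H) where
  carrier := {x | ∀ n, a ^ n ∣ gammaOp n x}
  zero_mem' := by
    intro n
    rw [gammaOp_eq_coeff, gammaSeries_zero, coeff_one]
    split_ifs with hn
    · simp [hn]
    · exact dvd_zero _
  add_mem' := by
    intro x y hx hy n
    rw [gammaOp_eq_coeff, gammaSeries_add, coeff_mul]
    refine Finset.dvd_sum fun i hi => ?_
    rw [← Finset.HasAntidiagonal.mem_antidiagonal.1 hi, pow_add, gammaSeries, gammaSeries, coeff_mk, coeff_mk]
    exact mul_dvd_mul (hx _) (hy _)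
  neg_mem' := by
    intro x hx n
    induction n using Nat.strong_induction_on with
    | _ n ih =>
      cases n with
      | zero => simp
      | succ n =>
        -- The relation `γ_t(x) γ_t(-x) = 1` expresses `γ^(n+1)(-x)` through lower `γ`-operations of
        -- `-x`.
        have h := congrArg (coeff (n + 1)) (gammaSeries_add x (-x))
        rw [add_neg_cancel, gammaSeries_zero, coeff_one, if_neg n.succ_ne_zero, coeff_mul,
          Finset.Nat.antidiagonal_succ, Finset.sum_cons] at h
        simp only [gammaSeries, coeff_mk, gammaOp_zero, one_mul, Finset.sum_map] at h
        rw [eq_neg_of_add_eq_zero_left h.symm, dvd_neg]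
        refine Finset.dvd_sum fun i hi => ?_
        have hi' := Finset.HasAntidiagonal.mem_antidiagonal.1 hi
        have h1 := mul_dvd_mul (hx (i.1 + 1)) (ih i.2 (by omega))
        rw [← pow_add, show i.1 + 1 + i.2 = n + 1 by omega] at h1
        exact h1

/-- Here `γ_t` is linear in `t`, so only `χ - 1 ∣ χ^j - 1` has content. -/
theorem ofLinear_sub_one_mem_gammaDvd (χ : H →* ℂ) (j : ℕ) :
    ofLinear χ ^ j - 1 ∈ gammaDvd (ofLinear χ - 1) := by
  intro n
  rw [gammaOp_eq_coeff, ofLinear_pow, gammaSeries_sub_one (evalAt_pow_ofLinear _), ← ofLinear_pow]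
  match n with
  | 0 => simp
  | 1 => simpa [coeff_one] using sub_one_dvd_pow_sub_one _ _
  | n + 2 => simp [coeff_one, coeff_succ_mul_X, -map_sub]

theorem mem_gammaDvd_of_augmentation_eq_zero [IsCyclic H] {χ : H →* ℂ}
    (hχ : Function.Injective χ) {x : VirtualChar H} (hx : augmentation H x = 0) :
    x ∈ gammaDvd (ofLinear χ - 1) := by
  have key : ∀ y : VirtualChar H, ∃ m : ℤ, y - m ∈ gammaDvd (ofLinear χ - 1) := by
    intro y
    have hy : y ∈ AddSubgroup.closure (Set.range fun j : ℕ => ofLinear χ ^ j) := by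
      rw [closure_powers_ofLinear_eq_top hχ]
      exact AddSubgroup.mem_top y
    induction hy using AddSubgroup.closure_induction with
    | mem y hy =>
      obtain ⟨j, rfl⟩ := hy
      exact ⟨1, by simpa using ofLinear_sub_one_mem_gammaDvd χ j⟩
    | zero => exact ⟨0, by simp⟩
    | add y z _ _ hy hz =>
      obtain ⟨m, hm⟩ := hy
      obtain ⟨n, hn⟩ := hz
      refine ⟨m + n, ?_⟩
      have := add_mem hm hn
      rwa [← add_sub_add_comm, ← Int.cast_add] at this
    | neg y _ hy =>
      obtain ⟨m, hm⟩ := hy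
      refine ⟨-m, ?_⟩
      have := neg_mem hm
      rwa [neg_sub', ← Int.cast_neg] at this
  obtain ⟨m, hm⟩ := key x
  -- Divisibility of `γ¹(x - m) = x - m` by `χ - 1` puts `x - m` in the augmentation ideal; as `x`
  -- lies there too, `m = 0`.
  obtain ⟨c, hc⟩ := hm 1
  rw [gammaOp_one, pow_one] at hc
  have h0 := congrArg (augmentation H) hc
  rw [map_sub, map_mul, map_sub, hx, augmentation_ofLinear, map_one, sub_self, zero_mul,
    map_intCast, zero_sub, neg_eq_zero, Int.cast_eq_zero] at h0
  simpa [h0] using hm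

/-- Each factor `γ^(n_i)(x_i)` of a monomial contributes `(χ - 1)^(n_i)`. -/
theorem dvd_of_mem_grothendieckFiltration [IsCyclic H] {χ : H →* ℂ}
    (hχ : Function.Injective χ) {n : ℕ} {y : VirtualChar H}
    (hy : y ∈ grothendieckFiltration H n) : (ofLinear χ - 1) ^ n ∣ y := by
  induction hy using AddSubgroup.closure_induction with
  | mem y hy =>
    obtain ⟨l, hl, hn, rfl⟩ := hy
    refine (pow_dvd_pow _ hn).trans ?_
    clear hn
    induction l with
    | nil => simp
    | cons q l ih =>
      simp only [List.map_cons, List.sum_cons, List.prod_cons, pow_add]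
      refine mul_dvd_mul ?_ (ih fun q hq => hl q (List.mem_cons_of_mem _ hq))
      exact mem_gammaDvd_of_augmentation_eq_zero hχ (hl q List.mem_cons_self) _
  | zero => exact dvd_zero _
  | add y z _ _ hy hz => exact dvd_add hy hz
  | neg y _ hy => exact (dvd_neg).2 hy

end Linear

/-! ### Compatibility criteria for cyclic subgroups -/

/-- A cyclic subgroup `H` is compatible with the Grothendieck filtrations if some element of
`R(G)` restricts to `χ + χ⁻¹` for a faithful linear character `χ` of `H`. -/
theorem isGammaCompatible_of_faithful {G : Type} [Group G] [Finite G] {H : Subgroup G}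
    [IsCyclic H] {χ χ' : H →* ℂ} (hχ : Function.Injective χ) (hinv : ∀ g, χ g * χ' g = 1)
    {v : VirtualChar G} (hv : ∀ g : H, evalAt (g : G) v = χ g + χ' g) : IsGammaCompatible H := by
  set a := ofLinear χ
  set a' := ofLinear χ'
  have haa : a * a' = 1 := ext_evalAt fun g => by
    rw [map_mul, map_one]
    exact hinv g
  have hra : res H.subtype (v - 2) = (a - 1) + (a' - 1) := by
    refine ext_evalAt fun g => ?_
    have h2 : evalAt g (res H.subtype v) = χ g + χ' g := hv g
    simp only [map_sub, map_add, map_one, h2, map_ofNat, a, a', evalAt_ofLinear]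
    ring
  have hw : augmentation G (v - 2) = 0 := by
    have h1 := hv 1
    rw [map_one, map_one, Subgroup.coe_one] at h1
    rw [map_sub, augmentation_eq_evalAt, h1, map_ofNat]
    norm_num
  have hres : res H.subtype (gammaOp 2 (v - 2)) = (a - 1) * (a' - 1) := by
    rw [← gammaOp_res, hra, gammaOp_eq_coeff, gammaSeries_add, gammaSeries_sub_one (evalAt_pow_ofLinear _),
      gammaSeries_sub_one (evalAt_pow_ofLinear _)]
    have h3 : (1 + C (a - 1) * X) * (1 + C (a' - 1) * X) =
        1 + C (a - 1 + (a' - 1)) * X + C ((a - 1) * (a' - 1)) * X ^ 2 := by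
      simp only [map_add, map_mul]
      ring
    rw [h3]
    rw [map_add, map_add, coeff_C_mul, coeff_C_mul]
    simp [coeff_one, coeff_X, coeff_X_pow]
  -- As `a a' = 1`, one has `-a (a' - 1) = a - 1`.
  have hsq : (a - 1) ^ 2 = res H.subtype (gammaOp 2 (v - 2)) * -a := by
    rw [hres]
    linear_combination (a - 1) * haa
  have hpow : ∀ (k : ℕ) (y : VirtualChar H), induction H ((a - 1) ^ (2 * k) * y) =
      gammaOp 2 (v - 2) ^ k * induction H ((-a) ^ k * y) := by
    intro k y
    rw [pow_mul, hsq, mul_pow, mul_assoc, ← map_pow, induction_res_mul]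
  rintro n _ ⟨y, hy, rfl⟩
  obtain ⟨c, rfl⟩ := dvd_of_mem_grothendieckFiltration hχ hy
  -- For odd `n` one factor `a - 1` stays under the induction; it makes the induced factor of degree
  -- zero, which supplies the missing weight one.
  obtain ⟨k, rfl | rfl⟩ := n.even_or_odd'
  · exact (hpow k c) ▸ gammaOp_two_pow_mul_mem_even hw _ k
  · rw [pow_succ, mul_assoc]
    refine (hpow k _) ▸ gammaOp_two_pow_mul_mem_odd hw (augmentation_induction H ?_) k
    rw [map_mul, map_mul, map_sub, augmentation_ofLinear, map_one, sub_self, zero_mul, mul_zero]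

/-- A cyclic subgroup `H` is compatible with the Grothendieck filtrations if some two-dimensional
representation of `G` restricts to a faithful representation of `H` of determinant one. -/
theorem isGammaCompatible_of_matrix {G : Type} [Group G] [Finite G] {H : Subgroup G}
    [IsCyclic H] (ρ : G →* Matrix (Fin 2) (Fin 2) ℂ) (hdet : ∀ g ∈ H, (ρ g).det = 1)
    (hinj : ∀ g ∈ H, ρ g = 1 → g = 1) : IsGammaCompatible H := by
  let σ : Representation ℂ G (Fin 2 → ℂ) :=
    (Matrix.toLinAlgEquiv' : Matrix (Fin 2) (Fin 2) ℂ ≃ₐ[ℂ] _).toAlgHom.toMonoidHom.comp ρ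
  have hσdet : ∀ g : H, LinearMap.det (σ g) = 1 := fun g =>
    (LinearMap.det_toLin' (ρ g)).trans (hdet g g.2)
  obtain ⟨h, hh⟩ := IsCyclic.exists_generator (α := H)
  obtain ⟨d, b, μ, hb⟩ := exists_eigenbasis (σ h) Nat.card_pos.ne' (rep_pow_card σ h)
  have hd : d = 2 := by
    have := Module.finrank_eq_card_basis b
    simpa using this.symm
  subst hd
  -- An eigenbasis for the generator diagonalises all of `H`; the diagonal entries are the two
  -- linear characters, with product the determinant.
  have heig : ∀ (i : Fin 2) (g : H), σ g (b i) = b.repr (σ g (b i)) i • b i := by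
    intro i g
    obtain ⟨k, rfl⟩ := mem_powers_iff_mem_zpowers.2 (hh g)
    have hpow : σ ((h ^ k : H) : G) (b i) = μ i ^ k • b i := by
      rw [Subgroup.coe_pow, map_pow, pow_apply_eigenvector (hb i)]
    change σ ((h ^ k : H) : G) (b i) = b.repr (σ ((h ^ k : H) : G) (b i)) i • b i
    rw [hpow]
    simp
  let χ : Fin 2 → H →* ℂ := fun i =>
    { toFun := fun g => b.repr (σ g (b i)) i
      map_one' := by simp
      map_mul' := fun g g' => by
        rw [Subgroup.coe_mul, map_mul, Module.End.mul_apply, heig i g', map_smul]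
        simp [mul_comm] }
  have hχ : ∀ (i : Fin 2) (g : H), σ g (b i) = χ i g • b i := heig
  have hprod : ∀ g : H, χ 0 g * χ 1 g = 1 := by
    intro g
    rw [← hσdet g, ← LinearMap.det_toMatrix b, Matrix.det_fin_two]
    simp [LinearMap.toMatrix_apply, hχ]
  refine isGammaCompatible_of_faithful (χ := χ 0) (χ' := χ 1) (v := ofRep σ) ?_ hprod ?_
  -- Determinant one forces `χ 1 g = 1` once `χ 0 g = 1`, so the kernel of `χ 0` is that of the
  -- whole representation.
  · rw [injective_iff_map_eq_one]
    intro g h0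
    have h1 := hprod g
    rw [h0, one_mul] at h1
    have hone : σ g = 1 := by
      refine b.ext fun i => ?_
      rw [hχ]
      fin_cases i
      · simp [h0]
      · simp [h1]
    refine Subtype.ext (hinj g g.2 ?_)
    exact Matrix.toLinAlgEquiv'.injective (hone.trans (map_one _).symm)
  · intro g
    exact (trace_of_eigenbasis _ b _ fun i => hχ i g).trans (Fin.sum_univ_two _)

/-! ### The two-dimensional representations -/

open ZMod

/-- The two-dimensional irreducible representation of the quaternion group. -/
def quaternionRep : QuaternionGroup 2 →* Matrix (Fin 2) (Fin 2) ℂ where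
  toFun
    | .a i => !![stdAddChar i, 0; 0, stdAddChar (-i)]
    | .xa i => !![0, -stdAddChar (-i); stdAddChar i, 0]
  map_one' := by
    rw [QuaternionGroup.one_def]
    simp [Matrix.one_fin_two]
  map_mul' := by
    -- The relation needed for products of two `xa` elements: the value at 2 squares to 1, and
    -- differs from 1 because `stdAddChar` is injective.
    have h2 : (stdAddChar (N := 2 * 2) 2 : ℂ) = -1 := by
      have h : (stdAddChar (N := 2 * 2) 2 : ℂ) ^ 2 = 1 := by
        rw [← AddChar.map_nsmul_eq_pow, ← AddChar.map_zero_eq_one (stdAddChar (N := 2 * 2))]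
        rfl
      refine (mul_self_eq_one_iff.1 (by rw [← sq, h])).resolve_left fun h1 => ?_
      rw [← AddChar.map_zero_eq_one (stdAddChar (N := 2 * 2))] at h1
      exact absurd (injective_stdAddChar h1) (by decide)
    have h2' : (stdAddChar (N := 2 * 2) (-2) : ℂ) = -1 := by
      rw [← h2]
      rfl
    rintro (i | i) (j | j)
    · simp [AddChar.map_add_eq_mul, mul_comm]
    · simp [sub_eq_add_neg, AddChar.map_add_eq_mul, mul_comm]
    · simp [AddChar.map_add_eq_mul, mul_comm]
    · simp [sub_eq_add_neg, AddChar.map_add_eq_mul, mul_comm, h2, h2']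

/-- The standard representation of the dihedral group, over `ℂ`. -/
def dihedralRep (p : ℕ) [NeZero p] : DihedralGroup p →* Matrix (Fin 2) (Fin 2) ℂ where
  toFun
    | .r i => !![stdAddChar i, 0; 0, stdAddChar (-i)]
    | .sr i => !![0, stdAddChar (-i); stdAddChar i, 0]
  map_one' := by
    rw [DihedralGroup.one_def]
    simp [Matrix.one_fin_two]
  map_mul' := by
    rintro (i | i) (j | j) <;>
      simp [sub_eq_add_neg, AddChar.map_add_eq_mul, mul_comm]

/-- Twice the sign representation of the dihedral group. -/
def dihedralSignRep (p : ℕ) : DihedralGroup p →* Matrix (Fin 2) (Fin 2) ℂ where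
  toFun
    | .r _ => !![1, 0; 0, 1]
    | .sr _ => !![-1, 0; 0, -1]
  map_one' := by
    rw [DihedralGroup.one_def]
    simp [Matrix.one_fin_two]
  map_mul' := by
    rintro (i | i) (j | j) <;> simp

/-! ### Subgroups of `Q₈` and `D_p` -/

theorem isGammaCompatible_quaternionGroup (H : Subgroup (QuaternionGroup 2)) :
    IsGammaCompatible H := by
  have hcard : Nat.card (QuaternionGroup 2) = 8 := by
    rw [Nat.card_eq_fintype_card, QuaternionGroup.card]
  by_cases hH : H = ⊤
  · rw [hH]
    exact isGammaCompatible_top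
  -- A proper subgroup has order at most 4, so an element of order 4 generates it; otherwise it lies
  -- in `{1, a 2}`, since `a 2` is the only involution.
  have hcyc : ∃ h, Subgroup.zpowers h = H := by
    by_cases h4 : ∃ h ∈ H, orderOf h = 4
    · obtain ⟨h, hh, h4⟩ := h4
      refine ⟨h, Subgroup.eq_of_le_of_card_ge (Subgroup.zpowers_le.2 hh) ?_⟩
      rw [Nat.card_zpowers, h4]
      have hd := H.card_subgroup_dvd_card
      rw [hcard] at hd
      have hne : Nat.card H ≠ 8 := fun h => hH (H.eq_top_of_card_eq (h.trans hcard.symm))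
      have := Nat.le_of_dvd (by norm_num) hd
      interval_cases Nat.card H <;> omega
    · have hsq : ∀ g : QuaternionGroup 2, g ^ 2 ≠ 1 → orderOf g = 4 := fun g hg =>
        orderOf_eq_prime_pow (p := 2) (n := 1) hg (by revert g; decide)
      have hinv : ∀ g : QuaternionGroup 2, g ^ 2 = 1 → g = 1 ∨ g = .a 2 := by decide
      have hmem : ∀ g ∈ H, g = 1 ∨ g = .a 2 := fun g hg =>
        hinv g (by_contra fun h => h4 ⟨g, hg, hsq g h⟩)
      by_cases ha : QuaternionGroup.a 2 ∈ H
      · refine ⟨.a 2, le_antisymm (Subgroup.zpowers_le.2 ha) fun g hg => ?_⟩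
        obtain rfl | rfl := hmem g hg
        · exact one_mem _
        · exact Subgroup.mem_zpowers _
      · refine ⟨1, le_antisymm (Subgroup.zpowers_le.2 H.one_mem) fun g hg => ?_⟩
        obtain rfl | rfl := hmem g hg
        · exact one_mem _
        · exact absurd hg ha
  obtain ⟨h, rfl⟩ := hcyc
  refine isGammaCompatible_of_matrix quaternionRep (fun g _ => ?_) (fun g _ hg => ?_)
  · obtain i | i := g <;> simp [quaternionRep, Matrix.det_fin_two, ← AddChar.map_add_eq_mul]
  · obtain i | i := g
    · have h0 : stdAddChar i = (1 : ℂ) := by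
        simpa [quaternionRep] using congrFun (congrFun hg 0) 0
      rw [← AddChar.map_zero_eq_one (stdAddChar (N := 2 * 2))] at h0
      rw [injective_stdAddChar h0, QuaternionGroup.a_zero]
    · have h0 := congrFun (congrFun hg 0) 0
      simp [quaternionRep] at h0

theorem isGammaCompatible_dihedralGroup (p : ℕ) [Fact p.Prime] (hp : Odd p)
    (H : Subgroup (DihedralGroup p)) : IsGammaCompatible H := by
  have hpp : p.Prime := Fact.out
  by_cases hH : H = ⊤
  · rw [hH]
    exact isGammaCompatible_top
  by_cases hr : ∃ i, DihedralGroup.sr i ∈ H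
  · obtain ⟨i, hi⟩ := hr
    have h2 : 2 ∣ Nat.card H := by
      rw [← DihedralGroup.orderOf_sr i]
      exact Subgroup.orderOf_dvd_natCard H hi
    -- The order is `2m` with `m ∣ p`, and `m = p` would give the whole group.
    have hcard : Nat.card H = 2 := by
      obtain ⟨m, hm⟩ := h2
      have hd := H.card_subgroup_dvd_card
      rw [DihedralGroup.nat_card, hm] at hd
      obtain rfl | rfl := (Nat.dvd_prime hpp).1 (Nat.dvd_of_mul_dvd_mul_left two_pos hd)
      · exact hm
      · exact absurd (H.eq_top_of_card_eq (by rw [DihedralGroup.nat_card, hm])) hH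
    have : IsCyclic H := isCyclic_of_prime_card (p := 2) hcard
    -- The standard representation has determinant `-1` on reflections. Twice the sign has
    -- determinant one, and is faithful on `H` because a rotation in `H` has order dividing both 2
    -- and the odd `p`.
    refine isGammaCompatible_of_matrix (dihedralSignRep p) (fun g _ => ?_) (fun g hgH hg => ?_)
    · obtain i | i := g <;> simp [dihedralSignRep, Matrix.det_fin_two]
    · obtain i | i := g
      · have h1 : orderOf (DihedralGroup.r i) ∣ 2 := hcard ▸ Subgroup.orderOf_dvd_natCard H hgH
        have h2 : orderOf (DihedralGroup.r i) ∣ p :=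
          orderOf_dvd_of_pow_eq_one (by simp [DihedralGroup.r_pow])
        exact orderOf_eq_one_iff.1 (Nat.eq_one_of_dvd_coprimes hp.coprime_two_left h1 h2)
      · have h0 := congrFun (congrFun hg 0) 0
        norm_num [dihedralSignRep] at h0
  · push Not at hr
    have hle : H ≤ Subgroup.zpowers (DihedralGroup.r 1) := by
      rintro (i | i) hi
      · exact ⟨i.val, by simp⟩
      · exact absurd hi (hr i)
    have : IsCyclic H := Subgroup.isCyclic_of_le hle
    refine isGammaCompatible_of_matrix (dihedralRep p) (fun g hgH => ?_) (fun g hgH hg => ?_)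
    · obtain i | i := g
      · simp [dihedralRep, Matrix.det_fin_two, ← AddChar.map_add_eq_mul]
      · exact absurd hgH (hr i)
    · obtain i | i := g
      · have h0 : stdAddChar i = (1 : ℂ) := by
          simpa [dihedralRep] using congrFun (congrFun hg 0) 0
        rw [← AddChar.map_zero_eq_one (stdAddChar (N := p))] at h0
        rw [injective_stdAddChar h0, DihedralGroup.r_zero]
      · exact absurd hgH (hr i)

end CharacterRing

end

theorem mainTheorem9 :
    (CharacterRing.IsSaturated (QuaternionGroup 2) ∧
      ∀ H : Subgroup (QuaternionGroup 2), CharacterRing.IsGammaCompatible H) ∧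
    ∀ (p : ℕ) [Fact p.Prime], Odd p →
      (CharacterRing.IsSaturated (DihedralGroup p) ∧
        ∀ H : Subgroup (DihedralGroup p), CharacterRing.IsGammaCompatible H) :=
  ⟨⟨CharacterRing.isSaturated_of_isGammaCompatible
      CharacterRing.isGammaCompatible_quaternionGroup,
    CharacterRing.isGammaCompatible_quaternionGroup⟩,
  fun p _ hp => ⟨CharacterRing.isSaturated_of_isGammaCompatible
      (CharacterRing.isGammaCompatible_dihedralGroup p hp),
    CharacterRing.isGammaCompatible_dihedralGroup p hp⟩⟩
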